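/- Let $N\ge 1$ and let $\mathcal G$ be a weighted directed graph on the nodes $1,\dots,N$ without self-loops, with adjacency matrix $A\in\mathbb R_{\ge 0}^{N\times N}$ ($A_{ij}>0$ if $(j,i)$ is an edge, $A_{ij}=0$ otherwise), and let $L=\operatorname{diag}(A\mathbf 1)-A$ be its Laplacian matrix. Let $\Delta>0$, let $q(z)=\left\lfloor \frac z\Delta+\frac12\right\rfloor\Delta$ for $z\in\mathbb R$, and let $q$ act componentwise on $\mathbb R^N$. For an interval $I\subseteq\mathbb R$, a Krasowskii solution of $$\dot x=-L\,q(x)$$ on $I$ is a function $x$ that is absolutely continuous on every compact subinterval of $I$ and satisfies, for almost every $t\in I$, $$\dot x(t)\in \bigcap_{\delta>0}\overline{\mathrm{co}}\,\bigl(\{-L\,q(y): \|y-x(t)\|<\delta\}\bigr);$$ it is complete if $I=[0,+\infty)$. Then: (i) for every $x^0\in\mathbb R^N$ there exists a complete Krasowskii solution $x$ with $x(0)=x^0$; (ii) for every Krasowskii solution $x$ on an interval $I$, the function $t\mapsto\min_i x_i(t)$ is nondecreasing on $I$ and $t\mapsto\max_i x_i(t)$ is nonincreasing on $I$; (iii)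 every Krasowskii solution on an interval $I\subseteq[0,+\infty)$ with $0\in I$ is the restriction to $I$ of a complete Krasowskii solution. -/

import Mathlib

open MeasureTheory

/-- A weighted directed graph on the nodes `Fin N`, without self-loops, given by its nonnegative
adjacency matrix: `weight i j` is positive when `(j, i)` is an edge, and zero otherwise. -/
structure WeightedDigraph (N : ℕ) where
  weight : Matrix (Fin N) (Fin N) ℝ
  weight_nonneg : ∀ i j, 0 ≤ weight i j
  weight_self : ∀ i, weight i i = 0

namespace WeightedDigraph

variable {N : ℕ}

/-- The in-degree of node `i`. -/
def inDegree (G : WeightedDigraph N) (i : Fin N) : ℝ := ∑ j, G.weight i j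

/-- The Laplacian matrix `L = D - A`, where `D` is the diagonal matrix of in-degrees. -/
def laplacian (G : WeightedDigraph N) : Matrix (Fin N) (Fin N) ℝ :=
  Matrix.diagonal G.inDegree - G.weight

end WeightedDigraph

/-- The uniform quantizer of step `Δ`. -/
noncomputable def uniformQuantizer (Δ : ℝ) (z : ℝ) : ℝ := (⌊z / Δ + 1 / 2⌋ : ℝ) * Δ

/-- The vector field `x ↦ -L q(x)`, with the quantizer `q` applied componentwise. -/
noncomputable def quantizedField {N : ℕ} (G : WeightedDigraph N) (Δ : ℝ)
    (x : EuclideanSpace ℝ (Fin N)) : EuclideanSpace ℝ (Fin N) :=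
  WithLp.toLp 2 (-(G.laplacian.mulVec fun i => uniformQuantizer Δ (x i)))

/-- The Krasowskii set-valued map: the intersection over `δ > 0` of the closed convex hulls of the
images of the balls of radius `δ` centered at `x`. -/
def krasowskii {E : Type*} [NormedAddCommGroup E] [NormedSpace ℝ E] (f : E → E) (x : E) : Set E :=
  ⋂ δ : ℝ, ⋂ _ : 0 < δ, closure (convexHull ℝ (f '' Metric.ball x δ))

/-- `x` is a Krasowskii solution of `x' = f(x)` on the interval `I`: it is absolutely continuous on
each compact subinterval of `I`, and at almost every `t ∈ I` it is differentiable with derivative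
in `krasowskii f (x t)`. Only the values of `x` on `I` matter, as the endpoints of `I` are a null
set. -/
structure IsKrasowskiiSolutionOn {E : Type*} [NormedAddCommGroup E] [NormedSpace ℝ E]
    (f : E → E) (x : ℝ → E) (I : Set ℝ) : Prop where
  absolutelyContinuous : ∀ a ∈ I, ∀ b ∈ I, AbsolutelyContinuousOnInterval x a b
  ae_inclusion : ∀ᵐ t ∂(volume.restrict I), ∃ v ∈ krasowskii f (x t), HasDerivAt x v t

/-- A complete Krasowskii solution is one on the interval `[0, +∞)`. -/
def IsCompleteKrasowskiiSolution {E : Type*} [NormedAddCommGroup E] [NormedSpace ℝ E]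
    (f : E → E) (x : ℝ → E) : Prop :=
  IsKrasowskiiSolutionOn f x (Set.Ici 0)

/-- The minimum of the components of `x`. -/
noncomputable def minCoord {N : ℕ} [NeZero N] (x : EuclideanSpace ℝ (Fin N)) : ℝ :=
  Finset.univ.inf' Finset.univ_nonempty fun i => x i

/-- The maximum of the components of `x`. -/
noncomputable def maxCoord {N : ℕ} [NeZero N] (x : EuclideanSpace ℝ (Fin N)) : ℝ :=
  Finset.univ.sup' Finset.univ_nonempty fun i => x i

/-! Existence: for small steps the Euler scheme preserves the box `quantizedBox`, where the field is
bounded. A pointwise limit of Euler polygons is Lipschitz, and its slopes are limits of averages of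
field values taken near `x t`, so its derivatives are Krasowskii velocities.

Monotonicity: away from the jumps of `q`, a minimal coordinate has the smallest quantized value
throughout a neighbourhood, so its velocity is nonnegative. At a jump the Krasowskii set may contain
velocities of the wrong sign, but a coordinate equals a given value with nonzero derivative at only
countably many times (`countable_setOf_eq_and_hasDerivAt_ne_zero`). Hence the minimum, being
absolutely continuous, is nondecreasing; the maximum is symmetric.

Extension: the extremes bound the solution, hence its velocity, so it is Lipschitz, has a limit at
`sSup I`, and can be glued to a complete solution starting there. -/

open Set Filter Topology
open scoped NNReal

/-! ### Krasowskii velocities as limits of Euler slopes. -/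

section Krasowskii

variable {E : Type*} [NormedAddCommGroup E] [NormedSpace ℝ E] {f : E → E}

theorem krasowskii_subset_of_eventually {x : E} {C : Set E} (hC : Convex ℝ C) (hC' : IsClosed C)
    (h : ∀ᶠ y in 𝓝 x, f y ∈ C) : krasowskii f x ⊆ C := by
  obtain ⟨δ, hδ, hb⟩ := Metric.eventually_nhds_iff_ball.1 h
  intro v hv
  have hv' : v ∈ closure (convexHull ℝ (f '' Metric.ball x δ)) := by
    simp only [krasowskii, mem_iInter] at hv
    exact hv δ hδ
  refine closure_minimal (convexHull_min ?_ hC) hC' hv'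
  rintro _ ⟨y, hy, rfl⟩
  exact hb y hy

/-- The explicit Euler iterates of step `h` for `x' = f x`. -/
def eulerSeq (f : E → E) (h : ℝ) (x₀ : E) : ℕ → E
  | 0 => x₀
  | k + 1 => eulerSeq f h x₀ k + h • f (eulerSeq f h x₀ k)

theorem eulerSeq_mem {S : Set E} {h : ℝ} {x₀ : E} (hS : ∀ y ∈ S, y + h • f y ∈ S)
    (hx₀ : x₀ ∈ S) (k : ℕ) : eulerSeq f h x₀ k ∈ S := by
  induction k with
  | zero => exact hx₀
  | succ k ih => exact hS _ ih

theorem eulerSeq_sub (f : E → E) (h : ℝ) (x₀ : E) {k l : ℕ} (hkl : k ≤ l) :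
    eulerSeq f h x₀ l - eulerSeq f h x₀ k = h • ∑ j ∈ Finset.Ico k l, f (eulerSeq f h x₀ j) := by
  induction l, hkl using Nat.le_induction with
  | base => simp
  | succ l hkl ih =>
    rw [Finset.sum_Ico_succ_top hkl, smul_add, ← ih]
    simp only [eulerSeq]
    abel

theorem norm_eulerSeq_sub_le {S : Set E} {M : ℝ} {h : ℝ} {x₀ : E} (hh : 0 ≤ h)
    (hM : ∀ y ∈ S, ‖f y‖ ≤ M) (hS : ∀ y ∈ S, y + h • f y ∈ S) (hx₀ : x₀ ∈ S) {k l : ℕ}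
    (hkl : k ≤ l) :
    ‖eulerSeq f h x₀ l - eulerSeq f h x₀ k‖ ≤ M * (h * ((l : ℝ) - k)) := by
  rw [eulerSeq_sub f h x₀ hkl, norm_smul, Real.norm_of_nonneg hh]
  have h1 : ‖∑ j ∈ Finset.Ico k l, f (eulerSeq f h x₀ j)‖ ≤ ∑ j ∈ Finset.Ico k l, M :=
    norm_sum_le_of_le _ fun j _ => hM _ (eulerSeq_mem hS hx₀ j)
  rw [Finset.sum_const, Nat.card_Ico, nsmul_eq_mul, Nat.cast_sub hkl] at h1
  calc h * _ ≤ h * (((l : ℝ) - k) * M) := by gcongr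
    _ = _ := by ring

/-- The slope is the average of `f` over the iterates from `k` to `l - 1`. -/
theorem eulerSeq_slope_mem {h : ℝ} (hh : 0 < h) {x₀ p : E} {δ : ℝ} {k l : ℕ} (hkl : k < l)
    (hb : ∀ j ∈ Finset.Ico k l, eulerSeq f h x₀ j ∈ Metric.ball p δ) :
    (h * ((l : ℝ) - k))⁻¹ • (eulerSeq f h x₀ l - eulerSeq f h x₀ k) ∈
      convexHull ℝ (f '' Metric.ball p δ) := by
  have hlk : (0 : ℝ) < (l : ℝ) - k := sub_pos.2 (by exact_mod_cast hkl)
  rw [eulerSeq_sub f h x₀ hkl.le, smul_smul, mul_inv, mul_comm h⁻¹, mul_assoc,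
    inv_mul_cancel₀ hh.ne', mul_one, Finset.smul_sum]
  refine (convex_convexHull ℝ _).sum_mem (fun _ _ => (inv_pos.2 hlk).le) ?_ fun j hj =>
    subset_convexHull ℝ _ (mem_image_of_mem f (hb j hj))
  rw [Finset.sum_const, Nat.card_Ico, nsmul_eq_mul, Nat.cast_sub hkl.le, mul_inv_cancel₀ hlk.ne']

theorem natFloor_mul_sub_le {r s t : ℝ} (hr : 0 < r) (hst : s ≤ t) :
    (⌊t * r⌋₊ : ℝ) - ⌊s * r⌋₊ ≤ (t - s) * r + 1 := by
  have h2 := (Nat.lt_floor_add_one (s * r)).le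
  rcases le_total 0 (t * r) with h | h
  · have := Nat.floor_le h
    linarith
  · rw [Nat.floor_of_nonpos h, Nat.cast_zero]
    have : (0 : ℝ) ≤ ⌊s * r⌋₊ := Nat.cast_nonneg _
    have : 0 ≤ (t - s) * r := mul_nonneg (sub_nonneg.2 hst) hr.le
    linarith

/-- If the Euler steps of small size leave invariant a set on which `f` is bounded, then the Euler
polygons have a pointwise limit along an ultrafilter, whose derivatives lie in the Krasowskii
map. -/
theorem exists_lipschitzWith_hasDerivAt_mem_krasowskii [ProperSpace E] {S : Set E} {M : ℝ≥0}
    {h₀ : ℝ} (hh₀ : 0 < h₀) (hM : ∀ y ∈ S, ‖f y‖ ≤ M)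
    (hS : ∀ h, 0 < h → h ≤ h₀ → ∀ y ∈ S, y + h • f y ∈ S) {x₀ : E} (hx₀ : x₀ ∈ S) :
    ∃ x : ℝ → E, LipschitzWith M x ∧ x 0 = x₀ ∧
      ∀ t, 0 ≤ t → ∀ v, HasDerivAt x v t → v ∈ krasowskii f (x t) := by
  set r : ℕ → ℝ := fun n => h₀⁻¹ + n with hr
  have hr0 : ∀ n, 0 < r n := fun n => by positivity
  have hrh : ∀ n, (r n)⁻¹ ≤ h₀ := fun n => by
    rw [inv_le_comm₀ (hr0 n) hh₀]
    simp [hr]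
  have hrt : Tendsto r atTop atTop :=
    tendsto_atTop_add_const_left _ _ tendsto_natCast_atTop_atTop
  -- A step function rather than a polygon: each jump costs at most one step, whence the extra `(r
  -- n)⁻¹` in `hlip`. For `t < 0` the floor is `0` and the value is `x₀`.
  set X : ℕ → ℝ → E := fun n t => eulerSeq f (r n)⁻¹ x₀ ⌊t * r n⌋₊ with hX
  have hSn : ∀ n, ∀ y ∈ S, y + (r n)⁻¹ • f y ∈ S := fun n =>
    hS _ (inv_pos.2 (hr0 n)) (hrh n)
  have hlip : ∀ n s t, ‖X n t - X n s‖ ≤ M * (|t - s| + (r n)⁻¹) := by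
    intro n s t
    wlog hst : s ≤ t generalizing s t
    · rw [norm_sub_rev, abs_sub_comm]
      exact this t s (le_of_not_ge hst)
    refine (norm_eulerSeq_sub_le (inv_pos.2 (hr0 n)).le hM (hSn n) hx₀
      (Nat.floor_mono (mul_le_mul_of_nonneg_right hst (hr0 n).le))).trans ?_
    gcongr
    rw [abs_of_nonneg (sub_nonneg.2 hst)]
    calc (r n)⁻¹ * _ ≤ (r n)⁻¹ * ((t - s) * r n + 1) := by
          have := (hr0 n).le
          gcongr
          exact natFloor_mul_sub_le (hr0 n) hst
      _ = _ := by
          have := (hr0 n).ne'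
          field_simp
  have hX0 : ∀ n, X n 0 = x₀ := fun n => by simp [hX, eulerSeq]
  have hrinv : Tendsto (fun n => (r n)⁻¹) atTop (𝓝 0) := tendsto_inv_atTop_zero.comp hrt
  -- Along an ultrafilter, bounded sequences converge for all `t` at once, so no subsequence needs
  -- to be extracted.
  let U : Ultrafilter ℕ := hyperfilter ℕ
  have hU : (U : Filter ℕ) ≤ atTop := Nat.hyperfilter_le_atTop
  have hlim : ∀ t, ∃ p, Tendsto (fun n => X n t) U (𝓝 p) := by
    intro t
    have hmem : ∀ n, X n t ∈ Metric.closedBall x₀ (M * (|t| + h₀)) := by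
      intro n
      rw [mem_closedBall_iff_norm]
      have := hlip n 0 t
      rw [hX0, sub_zero] at this
      refine this.trans ?_
      gcongr
      exact hrh n
    obtain ⟨p, -, hp⟩ := (isCompact_closedBall x₀ (M * (|t| + h₀))).ultrafilter_le_nhds
      (U.map fun n => X n t) (le_principal_iff.2 (mem_map.2 (Eventually.of_forall hmem)))
    exact ⟨p, hp⟩
  choose x hx using hlim
  refine ⟨x, LipschitzWith.of_dist_le_mul fun t s => ?_, ?_, ?_⟩
  · rw [dist_eq_norm, Real.dist_eq]
    have h2 : Tendsto (fun n => (M : ℝ) * (|t - s| + (r n)⁻¹)) U (𝓝 (M * |t - s|)) := by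
      have := ((hrinv.mono_left hU).const_add |t - s|).const_mul (M : ℝ)
      simpa using this
    exact le_of_tendsto_of_tendsto ((hx t).sub (hx s)).norm h2
      (Eventually.of_forall fun n => hlip n s t)
  · refine tendsto_nhds_unique (hx 0) ?_
    simp only [hX0]
    exact tendsto_const_nhds
  · intro t ht v hv
    have hτ : ∀ s, 0 ≤ s → Tendsto (fun n => (r n)⁻¹ * (⌊s * r n⌋₊ : ℝ)) U (𝓝 s) := by
      intro s hs
      have := (tendsto_nat_floor_mul_div_atTop hs).comp (hrt.mono_left hU)
      refine this.congr fun n => ?_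
      simp [div_eq_inv_mul]
    simp only [krasowskii, mem_iInter]
    intro δ hδ
    have hs : Tendsto (fun s => (M : ℝ) * (s - t)) (𝓝[>] t) (𝓝 0) := by
      have : Tendsto (fun s => (M : ℝ) * (s - t)) (𝓝 t) (𝓝 (M * (t - t))) := by
        apply Continuous.tendsto; fun_prop
      rw [sub_self, mul_zero] at this
      exact this.mono_left nhdsWithin_le_nhds
    have hslope : Tendsto (slope x t) (𝓝[>] t) (𝓝 v) :=
      (hasDerivAt_iff_tendsto_slope.1 hv).mono_left
        (nhdsWithin_mono _ fun s hs => ne_of_gt hs)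
    -- Right slopes suffice. With `M * (s - t) < δ / 2`, the iterates between times `t` and `s` stay
    -- in the `δ`-ball around `x t` for `U`-almost all `n`.
    refine isClosed_closure.mem_of_tendsto hslope ?_
    filter_upwards [hs.eventually (gt_mem_nhds (half_pos hδ)), self_mem_nhdsWithin] with s hsδ hts
    have hts' : t < s := hts
    have hτd : Tendsto (fun n => (r n)⁻¹ * ((⌊s * r n⌋₊ : ℝ) - ⌊t * r n⌋₊)) U (𝓝 (s - t)) := by
      simpa only [mul_sub] using (hτ s (ht.trans hts'.le)).sub (hτ t ht)
    have hconv : Tendsto (fun n => ((r n)⁻¹ * ((⌊s * r n⌋₊ : ℝ) - ⌊t * r n⌋₊))⁻¹ •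
        (X n s - X n t)) U (𝓝 (slope x t s)) := by
      rw [slope_def_module]
      exact (hτd.inv₀ (sub_pos.2 hts').ne').smul ((hx s).sub (hx t))
    refine mem_closure_of_tendsto hconv ?_
    filter_upwards [hτd.eventually (lt_mem_nhds (sub_pos.2 hts')),
      (hτd.const_mul (M : ℝ)).eventually (gt_mem_nhds hsδ),
      (hx t).eventually (Metric.ball_mem_nhds _ (half_pos hδ))] with n hn1 hn2 hn3
    have hkl : ⌊t * r n⌋₊ < ⌊s * r n⌋₊ := by
      have := pos_of_mul_pos_right hn1 (inv_pos.2 (hr0 n)).le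
      exact_mod_cast sub_pos.1 this
    refine eulerSeq_slope_mem (inv_pos.2 (hr0 n)) hkl fun j hj => ?_
    obtain ⟨hj1, hj2⟩ := Finset.mem_Ico.1 hj
    have h1 := norm_eulerSeq_sub_le (inv_pos.2 (hr0 n)).le hM (hSn n) hx₀ hj1
    have h2 : (M : ℝ) * ((r n)⁻¹ * ((j : ℝ) - ⌊t * r n⌋₊)) ≤
        M * ((r n)⁻¹ * ((⌊s * r n⌋₊ : ℝ) - ⌊t * r n⌋₊)) := by
      have := (hr0 n).le
      gcongr
    rw [Metric.mem_ball]
    rw [← dist_eq_norm] at h1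
    have h3 := dist_triangle (eulerSeq f (r n)⁻¹ x₀ j) (X n t) (x t)
    linarith

theorem LipschitzWith.isKrasowskiiSolutionOn [FiniteDimensional ℝ E] {K : ℝ≥0} {x : ℝ → E}
    (hx : LipschitzWith K x) {I : Set ℝ}
    (h : ∀ᵐ t ∂(volume.restrict I), ∀ v, HasDerivAt x v t → v ∈ krasowskii f (x t)) :
    IsKrasowskiiSolutionOn f x I where
  absolutelyContinuous _ _ _ _ := (hx.lipschitzOnWith).absolutelyContinuousOnInterval
  ae_inclusion := by
    filter_upwards [h, ae_restrict_of_ae hx.ae_differentiableAt_real] with t h1 h2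
    exact ⟨_, h1 _ h2.hasDerivAt, h2.hasDerivAt⟩

end Krasowskii

/-! ### Absolutely continuous functions and level sets. -/

theorem LipschitzWith.comp_absolutelyContinuousOnInterval {X Y : Type*} [PseudoMetricSpace X]
    [PseudoMetricSpace Y] {g : X → Y} {K : ℝ≥0} (hg : LipschitzWith K g) {x : ℝ → X} {a b : ℝ}
    (hx : AbsolutelyContinuousOnInterval x a b) :
    AbsolutelyContinuousOnInterval (fun t => g (x t)) a b := by
  unfold AbsolutelyContinuousOnInterval at hx ⊢
  refine squeeze_zero (fun _ => Finset.sum_nonneg fun _ _ => dist_nonneg) (fun P => ?_)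
    (by simpa using hx.const_mul (K : ℝ))
  rw [Finset.mul_sum]
  exact Finset.sum_le_sum fun i _ => hg.dist_le_mul _ _

theorem AbsolutelyContinuousOnInterval.le_of_ae_deriv_nonneg {m : ℝ → ℝ} {a b : ℝ} (hab : a ≤ b)
    (hm : AbsolutelyContinuousOnInterval m a b)
    (h : ∀ᵐ t ∂(volume.restrict (Icc a b)), ∀ v, HasDerivAt m v t → 0 ≤ v) : m a ≤ m b := by
  rw [← sub_nonneg, ← hm.integral_deriv_eq_sub]
  refine intervalIntegral.integral_nonneg_of_ae_restrict hab ?_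
  have hd := hm.ae_differentiableAt
  rw [uIcc_of_le hab, ← ae_restrict_iff' measurableSet_Icc] at hd
  filter_upwards [h, hd] with t h1 h2
  exact h1 _ h2.hasDerivAt

theorem AbsolutelyContinuousOnInterval.abs_sub_le_of_ae_abs_deriv_le {m : ℝ → ℝ} {a b C : ℝ}
    (hab : a ≤ b) (hm : AbsolutelyContinuousOnInterval m a b)
    (h : ∀ᵐ t ∂(volume.restrict (Icc a b)), ∃ v, |v| ≤ C ∧ HasDerivAt m v t) :
    |m b - m a| ≤ C * |b - a| := by
  rw [← hm.integral_deriv_eq_sub, ← Real.norm_eq_abs]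
  refine intervalIntegral.norm_integral_le_of_norm_le_const_ae ?_
  rw [ae_restrict_iff' measurableSet_Icc] at h
  filter_upwards [h] with t ht hmem
  rw [uIoc_of_le hab] at hmem
  obtain ⟨v, hv, hd⟩ := ht (Ioc_subset_Icc_self hmem)
  rwa [hd.deriv]

/-- A nonzero derivative isolates `t` in the level set, and a subset of the line has only countably
many isolated points. -/
theorem countable_setOf_eq_and_hasDerivAt_ne_zero (g : ℝ → ℝ) (c : ℝ) :
    {t | g t = c ∧ ∃ v, v ≠ 0 ∧ HasDerivAt g v t}.Countable := by
  refine (countable_setOfPred_isolated_right_within (s := {t | g t = c})).mono ?_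
  rintro t ⟨ht, v, hv, hd⟩
  refine ⟨ht, ?_⟩
  have h1 : ∀ᶠ s in 𝓝[≠] t, g s ≠ c := hd.eventually_ne hv
  rw [← empty_mem_iff_bot]
  have h2 : ∀ᶠ s in 𝓝[{t | g t = c} ∩ Ioi t] t, g s ≠ c :=
    h1.filter_mono (nhdsWithin_mono _ fun s hs => ne_of_gt hs.2)
  filter_upwards [h2, self_mem_nhdsWithin] with s hs1 hs2
  exact hs1 hs2.1

/-! ### Cells of the quantizer. -/

section Quantizer

variable {Δ : ℝ}

theorem uniformQuantizer_le_iff (hΔ : 0 < Δ) {z : ℝ} {k : ℤ} :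
    uniformQuantizer Δ z ≤ k * Δ ↔ z < (k + 1 / 2) * Δ := by
  rw [uniformQuantizer, mul_le_mul_iff_left₀ hΔ, Int.cast_le, ← Int.lt_add_one_iff, Int.floor_lt,
    ← div_lt_iff₀ hΔ]
  push_cast
  constructor <;> intro h <;> linarith

theorem le_uniformQuantizer_iff (hΔ : 0 < Δ) {z : ℝ} {k : ℤ} :
    k * Δ ≤ uniformQuantizer Δ z ↔ (k - 1 / 2) * Δ ≤ z := by
  rw [uniformQuantizer, mul_le_mul_iff_left₀ hΔ, Int.cast_le, Int.le_floor, ← le_div_iff₀ hΔ]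
  constructor <;> intro h <;> linarith

theorem exists_uniformQuantizer_eq (Δ z : ℝ) : ∃ k : ℤ, uniformQuantizer Δ z = k * Δ :=
  ⟨_, rfl⟩

theorem abs_uniformQuantizer_le_iff (hΔ : 0 < Δ) {z : ℝ} {K : ℕ} :
    |uniformQuantizer Δ z| ≤ K * Δ ↔ -((K + 1 / 2) * Δ) ≤ z ∧ z < (K + 1 / 2) * Δ := by
  have h1 := uniformQuantizer_le_iff hΔ (z := z) (k := (K : ℤ))
  have h2 := le_uniformQuantizer_iff hΔ (z := z) (k := -(K : ℤ))
  push_cast at h1 h2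
  rw [abs_le, h1, ← neg_mul, h2]
  have : (-(K : ℝ) - 1 / 2) * Δ = -((K + 1 / 2) * Δ) := by ring
  rw [this]

end Quantizer

/-! ### The quantized field: invariant boxes and signs of extreme coordinates. -/

section Field

variable {N : ℕ} (G : WeightedDigraph N) {Δ : ℝ}

theorem quantizedField_apply (Δ : ℝ) (y : EuclideanSpace ℝ (Fin N)) (i : Fin N) :
    quantizedField G Δ y i =
      ∑ j, G.weight i j * (uniformQuantizer Δ (y j) - uniformQuantizer Δ (y i)) := by
  simp only [quantizedField, WeightedDigraph.laplacian, WeightedDigraph.inDegree,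
    Matrix.sub_mulVec, Pi.sub_apply, Matrix.mulVec_diagonal, neg_sub, mul_sub,
    Finset.sum_sub_distrib, Finset.sum_mul]
  rfl

/-- The points whose quantized coordinates are bounded by `K` steps. -/
def quantizedBox (N : ℕ) (Δ : ℝ) (K : ℕ) : Set (EuclideanSpace ℝ (Fin N)) :=
  {y | ∀ j, |uniformQuantizer Δ (y j)| ≤ K * Δ}

theorem exists_norm_quantizedField_le (Δ : ℝ) (K : ℕ) :
    ∃ M : ℝ≥0, ∀ y ∈ quantizedBox N Δ K, ‖quantizedField G Δ y‖ ≤ M := by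
  have hc : IsCompact (univ.pi fun _ : Fin N => Icc (-(K * Δ)) (K * Δ)) :=
    isCompact_univ_pi fun _ => isCompact_Icc
  have hf : Continuous fun w : Fin N → ℝ => WithLp.toLp 2 (-(G.laplacian.mulVec w)) :=
    (PiLp.continuous_toLp 2 _).comp (Continuous.matrix_mulVec continuous_const continuous_id).neg
  obtain ⟨M, hM⟩ := hc.exists_bound_of_continuousOn hf.continuousOn
  exact ⟨M.toNNReal, fun y hy => (hM (fun i => uniformQuantizer Δ (y i)) fun j _ =>
    abs_le.1 (hy j)).trans (Real.le_coe_toNNReal M)⟩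

theorem exists_mem_nhds_quantizedBox (hΔ : 0 < Δ) (R : ℝ) :
    ∃ K, ∀ x : EuclideanSpace ℝ (Fin N), (∀ j, |x j| ≤ R) → quantizedBox N Δ K ∈ 𝓝 x := by
  obtain ⟨K, hK⟩ := exists_nat_gt (R / Δ)
  refine ⟨K, fun x hx => ?_⟩
  rw [div_lt_iff₀ hΔ] at hK
  have h : ∀ᶠ y : EuclideanSpace ℝ (Fin N) in 𝓝 x, ∀ j, |y j| < K * Δ :=
    eventually_all.2 fun j =>
      (Continuous.tendsto (by fun_prop : Continuous fun y : EuclideanSpace ℝ (Fin N) => |y j|)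
        x).eventually (gt_mem_nhds ((hx j).trans_lt hK))
  filter_upwards [h] with y hy j
  rw [abs_uniformQuantizer_le_iff hΔ]
  obtain ⟨h1, h2⟩ := abs_lt.1 (hy j)
  constructor <;> linarith

theorem krasowskii_quantizedField_subset_closedBall (hΔ : 0 < Δ) (R : ℝ) :
    ∃ M : ℝ≥0, ∀ x : EuclideanSpace ℝ (Fin N), (∀ j, |x j| ≤ R) →
      krasowskii (quantizedField G Δ) x ⊆ Metric.closedBall 0 M := by
  obtain ⟨K, hK⟩ := exists_mem_nhds_quantizedBox (N := N) hΔ R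
  obtain ⟨M, hM⟩ := exists_norm_quantizedField_le G Δ K
  refine ⟨M, fun x hx => krasowskii_subset_of_eventually (convex_closedBall _ _)
    Metric.isClosed_closedBall ?_⟩
  filter_upwards [hK x hx] with y hy
  simpa using hM y hy

theorem abs_quantizedField_apply_le {K : ℕ} {y : EuclideanSpace ℝ (Fin N)}
    (hy : y ∈ quantizedBox N Δ K) (i : Fin N) :
    |quantizedField G Δ y i| ≤ G.inDegree i * (2 * (K * Δ)) := by
  rw [quantizedField_apply, WeightedDigraph.inDegree, Finset.sum_mul]
  refine (Finset.abs_sum_le_sum_abs _ _).trans (Finset.sum_le_sum fun j _ => ?_)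
  rw [abs_mul, abs_of_nonneg (G.weight_nonneg i j)]
  refine mul_le_mul_of_nonneg_left ?_ (G.weight_nonneg i j)
  have := abs_sub (uniformQuantizer Δ (y j)) (uniformQuantizer Δ (y i))
  linarith [hy i, hy j]

theorem exists_step_add_quantizedField_mem (hΔ : 0 < Δ) (K : ℕ) :
    ∃ h₀ : ℝ, 0 < h₀ ∧ ∀ h, 0 < h → h ≤ h₀ → ∀ y ∈ quantizedBox N Δ K,
      y + h • quantizedField G Δ y ∈ quantizedBox N Δ K := by
  set D : ℝ := ∑ i, G.inDegree i with hD
  have hd : ∀ i, 0 ≤ G.inDegree i := fun i => Finset.sum_nonneg fun j _ => G.weight_nonneg i j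
  have hD0 : 0 ≤ D := Finset.sum_nonneg fun i _ => hd i
  have hdD : ∀ i, G.inDegree i ≤ D := fun i =>
    Finset.single_le_sum (f := G.inDegree) (fun i _ => hd i) (Finset.mem_univ i)
  -- A step then moves each coordinate by at most one cell width `Δ`, so only coordinates in the
  -- extreme cells could leave the box, and there the field does not point outward. The `+ 1` keeps
  -- the denominator positive.
  refine ⟨Δ / (D * (2 * (K * Δ)) + 1), by positivity, fun h hh hle y hy i => ?_⟩
  rw [le_div_iff₀ (by positivity)] at hle
  have hf : |h * quantizedField G Δ y i| ≤ Δ := by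
    rw [abs_mul, abs_of_pos hh]
    have h1 := abs_quantizedField_apply_le G hy i
    have h2 : G.inDegree i * (2 * (K * Δ)) ≤ D * (2 * (K * Δ)) := by
      gcongr
      exact hdD i
    have h3 : h * |quantizedField G Δ y i| ≤ h * (D * (2 * (K * Δ))) := by
      gcongr
      exact h1.trans h2
    linarith
  obtain ⟨hf1, hf2⟩ := abs_le.1 hf
  have hyi := (abs_uniformQuantizer_le_iff hΔ).1 (hy i)
  have hbd := abs_le.1 (hy i)
  rw [abs_uniformQuantizer_le_iff hΔ]
  simp only [PiLp.add_apply, PiLp.smul_apply, smul_eq_mul]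
  obtain ⟨k, hk⟩ := exists_uniformQuantizer_eq Δ (y i)
  constructor
  · rcases le_or_gt k (-(K : ℤ)) with hk1 | hk1
    · have : (k : ℝ) ≤ -K := by exact_mod_cast hk1
      have hq : (k : ℝ) * Δ ≤ -K * Δ := by gcongr
      have : 0 ≤ quantizedField G Δ y i := by
        rw [quantizedField_apply]
        refine Finset.sum_nonneg fun j _ => mul_nonneg (G.weight_nonneg i j) ?_
        linarith [(abs_le.1 (hy j)).1]
      linarith [mul_nonneg hh.le this]
    · have h1 : -(K : ℝ) + 1 ≤ k := by exact_mod_cast hk1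
      have h2 := (le_uniformQuantizer_iff hΔ).1 hk.ge
      have h3 : (-(K : ℝ) + 1 - 1 / 2) * Δ ≤ (k - 1 / 2) * Δ := by gcongr
      linarith
  · rcases le_or_gt (K : ℤ) k with hk1 | hk1
    · have : (K : ℝ) ≤ k := by exact_mod_cast hk1
      have hq : (K : ℝ) * Δ ≤ k * Δ := by gcongr
      have : quantizedField G Δ y i ≤ 0 := by
        rw [quantizedField_apply]
        refine Finset.sum_nonpos fun j _ =>
          mul_nonpos_of_nonneg_of_nonpos (G.weight_nonneg i j) ?_
        linarith [(abs_le.1 (hy j)).2]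
      linarith [mul_nonpos_of_nonneg_of_nonpos hh.le this]
    · have h1 : (k : ℝ) + 1 ≤ K := by exact_mod_cast hk1
      have h2 := (uniformQuantizer_le_iff hΔ).1 hk.le
      have h3 : ((k : ℝ) + 1 / 2 + 1) * Δ ≤ (K + 1 / 2) * Δ :=
        mul_le_mul_of_nonneg_right (by linarith) hΔ.le
      linarith

theorem exists_lipschitzWith_isCompleteKrasowskiiSolution (hΔ : 0 < Δ)
    (x₀ : EuclideanSpace ℝ (Fin N)) :
    ∃ (M : ℝ≥0) (x : ℝ → EuclideanSpace ℝ (Fin N)), LipschitzWith M x ∧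
      IsCompleteKrasowskiiSolution (quantizedField G Δ) x ∧ x 0 = x₀ := by
  obtain ⟨K, hK⟩ := exists_mem_nhds_quantizedBox (N := N) hΔ (∑ j, |x₀ j|)
  have hx₀ : x₀ ∈ quantizedBox N Δ K := mem_of_mem_nhds <| hK x₀ fun j =>
    Finset.single_le_sum (f := fun j => |x₀ j|) (fun j _ => abs_nonneg _) (Finset.mem_univ j)
  obtain ⟨M, hM⟩ := exists_norm_quantizedField_le G Δ K
  obtain ⟨h₀, hh₀, hS⟩ := exists_step_add_quantizedField_mem G hΔ K
  obtain ⟨x, hx, hx0, h⟩ := exists_lipschitzWith_hasDerivAt_mem_krasowskii hh₀ hM hS hx₀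
  exact ⟨M, x, hx, hx.isKrasowskiiSolutionOn
    (ae_restrict_of_forall_mem measurableSet_Ici fun t ht => h t ht), hx0⟩

theorem convex_setOf_le_coord (i : Fin N) (c : ℝ) :
    Convex ℝ {v : EuclideanSpace ℝ (Fin N) | c ≤ v i} :=
  (convex_Ici c).linear_preimage (EuclideanSpace.proj (𝕜 := ℝ) i).toLinearMap

theorem convex_setOf_coord_le (i : Fin N) (c : ℝ) :
    Convex ℝ {v : EuclideanSpace ℝ (Fin N) | v i ≤ c} :=
  (convex_Iic c).linear_preimage (EuclideanSpace.proj (𝕜 := ℝ) i).toLinearMap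

theorem exists_int_mem_quantizer_cell (hΔ : 0 < Δ) {z : ℝ}
    (hz : ∀ k : ℤ, z ≠ (k - 1 / 2) * Δ) :
    ∃ k : ℤ, (k - 1 / 2) * Δ < z ∧ z < (k + 1 / 2) * Δ := by
  obtain ⟨k, hk⟩ := exists_uniformQuantizer_eq Δ z
  exact ⟨k, lt_of_le_of_ne ((le_uniformQuantizer_iff hΔ).1 hk.ge) (hz k).symm,
    (uniformQuantizer_le_iff hΔ).1 hk.le⟩

theorem tendsto_coord (x : EuclideanSpace ℝ (Fin N)) (j : Fin N) :
    Tendsto (fun y : EuclideanSpace ℝ (Fin N) => y j) (𝓝 x) (𝓝 (x j)) :=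
  Continuous.tendsto (by fun_prop) x

/-- Near `x` every `y j` stays above the lower edge of the cell of `x i`, and `y i` below its upper
edge, so no `y j` is quantized below `y i`. At a jump, `y i` could be rounded up and its neighbours
down. -/
theorem krasowskii_quantizedField_coord_nonneg (hΔ : 0 < Δ) {x v : EuclideanSpace ℝ (Fin N)}
    {i : Fin N} (hi : ∀ j, x i ≤ x j) (hz : ∀ k : ℤ, x i ≠ (k - 1 / 2) * Δ)
    (hv : v ∈ krasowskii (quantizedField G Δ) x) : 0 ≤ v i := by
  obtain ⟨k, hk1, hk2⟩ := exists_int_mem_quantizer_cell hΔ hz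
  refine krasowskii_subset_of_eventually (convex_setOf_le_coord i 0)
    (isClosed_le continuous_const (by fun_prop)) ?_ hv
  have h : ∀ᶠ y : EuclideanSpace ℝ (Fin N) in 𝓝 x, ∀ j, (k - 1 / 2) * Δ < y j :=
    eventually_all.2 fun j =>
      (tendsto_coord x j).eventually (lt_mem_nhds (hk1.trans_le (hi j)))
  filter_upwards [h, (tendsto_coord x i).eventually (gt_mem_nhds hk2)] with y hy1 hy2
  rw [quantizedField_apply]
  refine Finset.sum_nonneg fun j _ => mul_nonneg (G.weight_nonneg i j) ?_
  linarith [(le_uniformQuantizer_iff hΔ).2 (hy1 j).le, (uniformQuantizer_le_iff hΔ).2 hy2]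

theorem krasowskii_quantizedField_coord_nonpos (hΔ : 0 < Δ) {x v : EuclideanSpace ℝ (Fin N)}
    {i : Fin N} (hi : ∀ j, x j ≤ x i) (hz : ∀ k : ℤ, x i ≠ (k - 1 / 2) * Δ)
    (hv : v ∈ krasowskii (quantizedField G Δ) x) : v i ≤ 0 := by
  obtain ⟨k, hk1, hk2⟩ := exists_int_mem_quantizer_cell hΔ hz
  refine krasowskii_subset_of_eventually (convex_setOf_coord_le i 0)
    (isClosed_le (by fun_prop) continuous_const) ?_ hv
  have h : ∀ᶠ y : EuclideanSpace ℝ (Fin N) in 𝓝 x, ∀ j, y j < (k + 1 / 2) * Δ :=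
    eventually_all.2 fun j =>
      (tendsto_coord x j).eventually (gt_mem_nhds ((hi j).trans_lt hk2))
  filter_upwards [h, (tendsto_coord x i).eventually (lt_mem_nhds hk1)] with y hy1 hy2
  rw [quantizedField_apply]
  refine Finset.sum_nonpos fun j _ => mul_nonpos_of_nonneg_of_nonpos (G.weight_nonneg i j) ?_
  linarith [(uniformQuantizer_le_iff hΔ).2 (hy1 j), (le_uniformQuantizer_iff hΔ).2 hy2.le]

end Field

/-! ### The extreme coordinates are 1-Lipschitz. -/

section Extremes

variable {N : ℕ} [NeZero N]

theorem minCoord_le (x : EuclideanSpace ℝ (Fin N)) (i : Fin N) : minCoord x ≤ x i :=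
  Finset.inf'_le _ (Finset.mem_univ i)

theorem le_maxCoord (x : EuclideanSpace ℝ (Fin N)) (i : Fin N) : x i ≤ maxCoord x :=
  Finset.le_sup' (fun i => x i) (Finset.mem_univ i)

theorem exists_minCoord_eq (x : EuclideanSpace ℝ (Fin N)) : ∃ i, minCoord x = x i := by
  obtain ⟨i, -, hi⟩ := Finset.exists_mem_eq_inf' Finset.univ_nonempty fun i => x i
  exact ⟨i, hi⟩

theorem exists_maxCoord_eq (x : EuclideanSpace ℝ (Fin N)) : ∃ i, maxCoord x = x i := by
  obtain ⟨i, -, hi⟩ := Finset.exists_mem_eq_sup' Finset.univ_nonempty fun i => x i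
  exact ⟨i, hi⟩

theorem lipschitzWith_coord {N : ℕ} (i : Fin N) :
    LipschitzWith 1 fun x : EuclideanSpace ℝ (Fin N) => x i :=
  LipschitzWith.of_dist_le_mul fun x y => by
    rw [NNReal.coe_one, one_mul, dist_eq_norm, dist_eq_norm]
    exact PiLp.norm_apply_le (x - y) i

theorem coord_le_coord_add_dist {N : ℕ} (x y : EuclideanSpace ℝ (Fin N)) (i : Fin N) :
    x i ≤ y i + dist x y := by
  have h := (lipschitzWith_coord i).dist_le_mul x y
  rw [NNReal.coe_one, one_mul, Real.dist_eq] at h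
  linarith [le_abs_self (x i - y i)]

theorem lipschitzWith_minCoord : LipschitzWith 1 (minCoord (N := N)) :=
  LipschitzWith.of_le_add fun x y => by
    obtain ⟨i, hi⟩ := exists_minCoord_eq y
    rw [hi]
    exact (minCoord_le x i).trans (coord_le_coord_add_dist x y i)

theorem lipschitzWith_maxCoord : LipschitzWith 1 (maxCoord (N := N)) :=
  LipschitzWith.of_le_add fun x y => by
    obtain ⟨i, hi⟩ := exists_maxCoord_eq x
    rw [hi]
    exact (coord_le_coord_add_dist x y i).trans (add_le_add_left (le_maxCoord y i) _)

end Extremes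

/-! ### Monotonicity of the extremes and extension of solutions. -/

section Solutions

variable {N : ℕ} {G : WeightedDigraph N} {Δ : ℝ} {I : Set ℝ}
  {x : ℝ → EuclideanSpace ℝ (Fin N)}

theorem HasDerivAt.coord {v : EuclideanSpace ℝ (Fin N)} {t : ℝ} (h : HasDerivAt x v t)
    (i : Fin N) : HasDerivAt (fun s => x s i) (v i) t :=
  (EuclideanSpace.proj (𝕜 := ℝ) i).hasFDerivAt.comp_hasDerivAt t h

/-- At almost every time, a coordinate that sits at a jump of the quantizer has zero derivative. -/
theorem ae_hasDerivAt_coord_eq_zero_of_jump (Δ : ℝ) (x : ℝ → EuclideanSpace ℝ (Fin N)) :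
    ∀ᵐ t, ∀ (i : Fin N) (k : ℤ), x t i = (k - 1 / 2) * Δ →
      ∀ v, HasDerivAt (fun s => x s i) v t → v = 0 := by
  refine ae_all_iff.2 fun i => ae_all_iff.2 fun k => ?_
  filter_upwards [(countable_setOf_eq_and_hasDerivAt_ne_zero (fun s => x s i)
    ((k - 1 / 2) * Δ)).ae_notMem volume] with t ht hk v hv
  by_contra hv0
  exact ht ⟨hk, v, hv0, hv⟩

namespace IsKrasowskiiSolutionOn

theorem ae_coord_nonneg_nonpos (hΔ : 0 < Δ) (hx : IsKrasowskiiSolutionOn (quantizedField G Δ) x I) :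
    ∀ᵐ t ∂(volume.restrict I), ∃ v : EuclideanSpace ℝ (Fin N), HasDerivAt x v t ∧
      (∀ i, (∀ j, x t i ≤ x t j) → 0 ≤ v i) ∧ ∀ i, (∀ j, x t j ≤ x t i) → v i ≤ 0 := by
  filter_upwards [hx.ae_inclusion,
    ae_restrict_of_ae (ae_hasDerivAt_coord_eq_zero_of_jump Δ x)] with t ht hj
  obtain ⟨v, hv, hd⟩ := ht
  refine ⟨v, hd, fun i hi => ?_, fun i hi => ?_⟩ <;>
    by_cases hz : ∀ k : ℤ, x t i ≠ (k - 1 / 2) * Δ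
  · exact krasowskii_quantizedField_coord_nonneg G hΔ hi hz hv
  · push Not at hz
    obtain ⟨k, hk⟩ := hz
    exact (hj i k hk _ (hd.coord i)).ge
  · exact krasowskii_quantizedField_coord_nonpos G hΔ hi hz hv
  · push Not at hz
    obtain ⟨k, hk⟩ := hz
    exact (hj i k hk _ (hd.coord i)).le

variable [NeZero N]

theorem monotoneOn_minCoord (hΔ : 0 < Δ) (hI : I.OrdConnected)
    (hx : IsKrasowskiiSolutionOn (quantizedField G Δ) x I) :
    MonotoneOn (fun t => minCoord (x t)) I := by
  intro a ha b hb hab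
  refine (lipschitzWith_minCoord.comp_absolutelyContinuousOnInterval
    (hx.absolutelyContinuous a ha b hb)).le_of_ae_deriv_nonneg hab ?_
  filter_upwards [ae_restrict_of_ae_restrict_of_subset (hI.out ha hb)
    (hx.ae_coord_nonneg_nonpos hΔ)] with t ⟨v, hd, hmin, _⟩ w hw
  obtain ⟨i, hi⟩ := exists_minCoord_eq (x t)
  -- The minimum lies below coordinate `i` and touches it at `t`, so the two derivatives agree.
  have hmax : IsLocalMax (fun s => minCoord (x s) - x s i) t := Eventually.of_forall fun s => by
    simp only [hi, sub_self]
    linarith [minCoord_le (x s) i]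
  have := hmax.hasDerivAt_eq_zero (hw.sub (hd.coord i))
  linarith [hmin i fun j => hi ▸ minCoord_le (x t) j]

theorem antitoneOn_maxCoord (hΔ : 0 < Δ) (hI : I.OrdConnected)
    (hx : IsKrasowskiiSolutionOn (quantizedField G Δ) x I) :
    AntitoneOn (fun t => maxCoord (x t)) I := by
  intro a ha b hb hab
  have hac : AbsolutelyContinuousOnInterval (fun t => -maxCoord (x t)) a b :=
    (lipschitzWith_maxCoord.comp_absolutelyContinuousOnInterval
      (hx.absolutelyContinuous a ha b hb)).fun_neg
  suffices h : -maxCoord (x a) ≤ -maxCoord (x b) from neg_le_neg_iff.1 h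
  refine AbsolutelyContinuousOnInterval.le_of_ae_deriv_nonneg (m := fun t => -maxCoord (x t))
    hab hac ?_
  filter_upwards [ae_restrict_of_ae_restrict_of_subset (hI.out ha hb)
    (hx.ae_coord_nonneg_nonpos hΔ)] with t ⟨v, hd, _, hmax⟩ w hw
  obtain ⟨i, hi⟩ := exists_maxCoord_eq (x t)
  have hloc : IsLocalMax (fun s => -maxCoord (x s) + x s i) t := Eventually.of_forall fun s => by
    simp only [hi, neg_add_cancel]
    linarith [le_maxCoord (x s) i]
  have := hloc.hasDerivAt_eq_zero (hw.add (hd.coord i))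
  linarith [hmax i fun j => hi ▸ le_maxCoord (x t) j]

theorem exists_lipschitzOnWith (hΔ : 0 < Δ) (hI : I.OrdConnected) (hI0 : I ⊆ Ici 0) (h0 : 0 ∈ I)
    (hx : IsKrasowskiiSolutionOn (quantizedField G Δ) x I) :
    ∃ M : ℝ≥0, LipschitzOnWith M x I := by
  have hR : ∀ t ∈ I, ∀ j, |x t j| ≤ max (maxCoord (x 0)) (-minCoord (x 0)) := by
    intro t ht j
    have h1 : minCoord (x 0) ≤ minCoord (x t) := hx.monotoneOn_minCoord hΔ hI h0 ht (hI0 ht)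
    have h2 : maxCoord (x t) ≤ maxCoord (x 0) := hx.antitoneOn_maxCoord hΔ hI h0 ht (hI0 ht)
    rw [abs_le']
    exact ⟨le_max_of_le_left ((le_maxCoord _ j).trans h2),
      le_max_of_le_right (neg_le_neg (h1.trans (minCoord_le _ j)))⟩
  obtain ⟨M, hM⟩ := krasowskii_quantizedField_subset_closedBall G hΔ
    (max (maxCoord (x 0)) (-minCoord (x 0)))
  have hM' : ∀ᵐ t ∂(volume.restrict I), ∃ v : EuclideanSpace ℝ (Fin N), ‖v‖ ≤ M ∧
      HasDerivAt x v t := by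
    filter_upwards [hx.ae_inclusion, ae_restrict_mem hI.measurableSet] with t ⟨v, hv, hd⟩ ht
    exact ⟨v, by simpa using hM (x t) (hR t ht) hv, hd⟩
  -- Scalar estimates give the Lipschitz bound in the sup norm; returning to the Euclidean norm only
  -- changes the constant.
  have hlip : LipschitzOnWith M (fun t => WithLp.ofLp (x t)) I := by
    refine LipschitzOnWith.of_dist_le_mul fun b hb a ha => ?_
    refine (dist_pi_le_iff (by positivity)).2 fun i => ?_
    wlog hab : a ≤ b generalizing a b
    · rw [dist_comm, dist_comm b]
      exact this a ha b hb (le_of_not_ge hab)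
    refine ((lipschitzWith_coord i).comp_absolutelyContinuousOnInterval
      (hx.absolutelyContinuous a ha b hb)).abs_sub_le_of_ae_abs_deriv_le hab ?_
    filter_upwards [ae_restrict_of_ae_restrict_of_subset (hI.out ha hb) hM'] with t ⟨v, hv, hd⟩
    exact ⟨v i, (PiLp.norm_apply_le v i).trans hv, hd.coord i⟩
  exact ⟨_, (PiLp.lipschitzWith_toLp 2 fun _ : Fin N => ℝ).comp_lipschitzOnWith hlip⟩

theorem exists_complete_eqOn (hΔ : 0 < Δ) (hI : I.OrdConnected) (hI0 : I ⊆ Ici 0) (h0 : 0 ∈ I)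
    (hx : IsKrasowskiiSolutionOn (quantizedField G Δ) x I) :
    ∃ y : ℝ → EuclideanSpace ℝ (Fin N),
      IsCompleteKrasowskiiSolution (quantizedField G Δ) y ∧ EqOn y x I := by
  by_cases hb : BddAbove I
  · obtain ⟨M, hM⟩ := hx.exists_lipschitzOnWith hΔ hI hI0 h0
    obtain ⟨w, hw, hwx⟩ := hM.extend_finite_dimension
    set b := sSup I with hbdef
    obtain ⟨K, z, hz, hzc, hz0⟩ :=
      exists_lipschitzWith_isCompleteKrasowskiiSolution G hΔ (w b)
    -- Since `z 0 = w b`, one formula covers both sides of `b` and is Lipschitz as a sum of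
    -- compositions.
    set y : ℝ → EuclideanSpace ℝ (Fin N) := fun t => w (min t b) + z (max (t - b) 0) - w b with hy
    have hyw : ∀ t ≤ b, y t = w t := fun t ht => by
      simp [hy, min_eq_left ht, max_eq_right (sub_nonpos.2 ht), hz0]
    have hyz : ∀ t, b ≤ t → y t = z (t - b) := fun t ht => by
      simp [hy, min_eq_right ht, max_eq_left (sub_nonneg.2 ht)]
    have hylip : LipschitzWith _ y :=
      ((hw.comp (LipschitzWith.id.min_const b)).add
        (hz.comp ((LipschitzWith.id.sub (LipschitzWith.const b)).max_const 0))).sub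
        (LipschitzWith.const (w b))
    refine ⟨y, hylip.isKrasowskiiSolutionOn ?_, fun t ht => ?_⟩
    · have h1 := (ae_restrict_iff' hI.measurableSet).1 hx.ae_inclusion
      have h2 := (measurePreserving_sub_right (volume : Measure ℝ) b).quasiMeasurePreserving.ae
        ((ae_restrict_iff' measurableSet_Ici).1 hzc.ae_inclusion)
      rw [ae_restrict_iff' measurableSet_Ici]
      filter_upwards [h1, h2, Measure.ae_ne volume b, Measure.ae_ne volume (0 : ℝ)]
        with t h1 h2 htb ht0 ht v hv
      rcases lt_or_gt_of_ne htb with htb | htb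
      · obtain ⟨c, hc, htc⟩ := exists_lt_of_lt_csSup ⟨0, h0⟩ htb
        have hIoo : Ioo 0 c ⊆ I := Ioo_subset_Icc_self.trans (hI.out h0 hc)
        have htI : t ∈ Ioo 0 c := ⟨lt_of_le_of_ne ht ht0.symm, htc⟩
        have heq : ∀ s ∈ Ioo 0 c, y s = x s := fun s hs =>
          (hyw s (le_csSup hb (hIoo hs))).trans (hwx (hIoo hs)).symm
        obtain ⟨v', hv', hd⟩ := h1 (hIoo htI)
        have hd' : HasDerivAt y v' t := hd.congr_of_eventuallyEq
          (mem_of_superset (Ioo_mem_nhds htI.1 htI.2) heq)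
        rw [heq t htI, hv.unique hd']
        exact hv'
      · obtain ⟨v', hv', hd⟩ := h2 (sub_nonneg.2 htb.le)
        have hd' : HasDerivAt y v' t := (hd.comp_sub_const t b).congr_of_eventuallyEq
          (mem_of_superset (Ioi_mem_nhds htb) fun s hs => hyz s (le_of_lt hs))
        rw [hyz t htb.le, hv.unique hd']
        exact hv'
    · rw [hyw t (le_csSup hb ht)]
      exact (hwx ht).symm
  · have hIci : I = Ici 0 := by
      refine hI0.antisymm fun t ht => ?_
      obtain ⟨c, hc, htc⟩ := not_bddAbove_iff.1 hb t
      exact hI.out h0 hc ⟨ht, htc.le⟩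
    subst hIci
    exact ⟨x, hx, fun _ _ => rfl⟩

end IsKrasowskiiSolutionOn

end Solutions

theorem mainTheorem8 {N : ℕ} [NeZero N] (G : WeightedDigraph N) (Δ : ℝ) (hΔ : 0 < Δ) :
    (∀ x₀ : EuclideanSpace ℝ (Fin N), ∃ x : ℝ → EuclideanSpace ℝ (Fin N),
      IsCompleteKrasowskiiSolution (quantizedField G Δ) x ∧ x 0 = x₀) ∧
    (∀ (I : Set ℝ) (x : ℝ → EuclideanSpace ℝ (Fin N)), I.OrdConnected →
      IsKrasowskiiSolutionOn (quantizedField G Δ) x I →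
        MonotoneOn (fun t => minCoord (x t)) I ∧ AntitoneOn (fun t => maxCoord (x t)) I) ∧
    (∀ (I : Set ℝ) (x : ℝ → EuclideanSpace ℝ (Fin N)), I.OrdConnected → I ⊆ Set.Ici 0 → 0 ∈ I →
      IsKrasowskiiSolutionOn (quantizedField G Δ) x I →
        ∃ y : ℝ → EuclideanSpace ℝ (Fin N),
          IsCompleteKrasowskiiSolution (quantizedField G Δ) y ∧ Set.EqOn y x I) := by
  refine ⟨fun x₀ => ?_,
    fun I x hI hx => ⟨hx.monotoneOn_minCoord hΔ hI, hx.antitoneOn_maxCoord hΔ hI⟩,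
    fun I x hI hI0 h0 hx => hx.exists_complete_eqOn hΔ hI hI0 h0⟩
  obtain ⟨-, x, -, hx, hx0⟩ := exists_lipschitzWith_isCompleteKrasowskiiSolution G hΔ x₀
  exact ⟨x, hx, hx0⟩
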